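/- Let $m\ge 1$ machines be given, where machine $i$ observes $X_i$ and $X_1,\dots,X_m$ are i.i.d. $N(\theta,\sigma^2)$ with $\sigma>0$ known and $\theta\in[0,1]$ unknown. For integers $b_1,\dots,b_m\ge 1$ let $\mathcal A(b_{1:m})$ be the class of distributed protocols $(\hat\theta,\Pi_1,\dots,\Pi_m)$, in which each machine sends the transcript $Z_i=\Pi_i(X_i)$, where $\Pi_i:\mathbb R\to\{0,1\}^{b_i}$ is a measurable, possibly random function, and the central machine outputs a real number $\hat\theta=\hat\theta(Z_1,\dots,Z_m)$, where $\hat\theta$ is again a possibly random function. The randomness used by the functions is independent of the data; otherwise their joint distribution is arbitrary (in particular, the functions may be deterministic or independent). Let $$R_1(b_{1:m})=\inf_{\hat\theta\in\mathcal A(b_{1:m})}\ \sup_{\theta\in[0,1]}\ \mathbb E(\hat\theta-\theta)^2$$ be the minimax risk, the expectation being over the data and the randomness of the protocol, and let $B=\sum_{i=1}^m b_i$. Then there is a universal constant $c>0$, independent of $m$, $b_{1:m}$ and $\sigma$, such that $$R_1(b_{1:m})\ \ge\ \begin{cases} c\cdot 2^{-2B} & \text{if } B<\log_2\frac1\sigma+2,\\[2pt]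 c\cdot\dfrac{\sigma^2}{B-\log_2\frac1\sigma} & \text{if } \log_2\frac1\sigma+2\le B<\log_2\frac1\sigma+m,\\[2pt] c\cdot\min\left\{\dfrac{\sigma^2}{m},1\right\} & \text{if } B\ge\log_2\frac1\sigma+m.\end{cases}$$ (When $m=1$ the first and the third condition can hold together; then both bounds hold.) -/

import Mathlib

open MeasureTheory ProbabilityTheory
open scoped ENNReal

/-- The class `𝒜(b₁, …, b_m)` of distributed protocols for real observations: machine `i` turns its
own observation into a string of `b i` bits by a possibly random function, and the central machine
computes the estimate from the `m` strings by a possibly random function. All the random functions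
are driven by a random seed drawn from `law` independently of the data (see `mse`). Their joint
distribution is arbitrary: deterministic protocols (one-point `Seed`), independent private
randomization on each machine (`Seed` a product of probability spaces, each function using its own
coordinate) and common randomness are all included. -/
structure DistributedProtocol {m : ℕ} (b : Fin m → ℕ) where
  /-- the sample space of the randomization -/
  Seed : Type
  /-- its measurable sets -/
  seedSpace : MeasurableSpace Seed
  /-- the law of the randomization -/
  law : Measure Seed
  law_prob : IsProbabilityMeasure law
  /-- the encoders `Πᵢ : ℝ → {0,1}^{bᵢ}` -/
  transcript : (i : Fin m) → Seed → ℝ → (Fin (b i) → Bool)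
  measurable_transcript :
    ∀ i, Measurable (fun p : Seed × ℝ => transcript i p.1 p.2)
  /-- the final estimator as a function of the transcripts -/
  estimator : Seed → ((i : Fin m) → Fin (b i) → Bool) → ℝ
  measurable_estimator : ∀ z, Measurable (fun s : Seed => estimator s z)

namespace DistributedProtocol

variable {m : ℕ} {b : Fin m → ℕ}

/-- The estimate `θ̂(Π₁(x₁), …, Π_m(x_m))` for seed `s` and data `x`. -/
def estimate (A : DistributedProtocol b) (s : A.Seed) (x : Fin m → ℝ) : ℝ :=
  A.estimator s (fun i => A.transcript i s (x i))

/-- The mean squared error `𝔼 (θ̂ - θ)²`, a value in `[0, ∞]`, when `X₁, …, X_m` are i.i.d. with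
law `N(θ, σ²)`. The expectation is over the data and over the seed, which is independent of them. -/
noncomputable def mse (A : DistributedProtocol b) (σ θ : ℝ) : ℝ≥0∞ :=
  letI := A.seedSpace
  ∫⁻ p : A.Seed × (Fin m → ℝ), ENNReal.ofReal ((A.estimate p.1 p.2 - θ) ^ 2)
    ∂(A.law.prod (Measure.pi (fun _ : Fin m => gaussianReal θ (σ ^ 2).toNNReal)))

end DistributedProtocol

/-- The minimax risk `R₁(b_{1:m}) = inf_{θ̂ ∈ 𝒜(b_{1:m})} sup_{θ ∈ [0,1]} 𝔼 (θ̂ - θ)²` over the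
Gaussian location family `{N(θ, σ²) : θ ∈ [0,1]}`. -/
noncomputable def distributedMinimaxRisk {m : ℕ} (b : Fin m → ℕ) (σ : ℝ) : ℝ≥0∞ :=
  ⨅ A : DistributedProtocol b, ⨆ θ ∈ Set.Icc (0 : ℝ) 1, A.mse σ θ

/-!
Conditionally on the seed a protocol is nonrandomized, so it suffices to bound from below, for every
nonrandomized protocol with estimator `e`, the average risk over a suitable finite set of means
(`ofReal_le_distributedMinimaxRisk`). Two of the bounds are elementary and hold for all parameters.
The estimate takes at most `2 ^ B` values, so it misses half of a grid of `2 ^ (B + 1)` means by the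
order of `2 ^ (-B)` (`le_sum_transcriptRisk_of_card`). And the messages carry no more information
than the data, so two means at distance `min (σ / √m) 1` cannot be told apart
(`sq_mul_exp_le_transcriptRisk_add`).

The bound `σ² / D` with `D = B - log₂ (1 / σ)` expresses that the bits spent on localizing the mean
to within `σ` are lost for refining it. It comes from two facts.

* Localization uses up entropy. On a grid of `N ≈ 1 / σ` means, a protocol whose mean squared error
  is of order `σ²` has transcripts whose entropy given the mean is on average at most
  `B log 2 - log N + O(1) = O(D)` (`sum_entropy_transcriptProb_le`). This is Gibbs' inequality for
  weights concentrated around the grid point closest to the estimate.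
* Refinement needs entropy. The function `t ↦ exp (t² / (2σ²)) * N(t, σ²)(A)` is log-convex by
  Hölder's inequality, and therefore `√(-log N(t, σ²)(A))` is Lipschitz in `t` with constant
  `1 / (σ √2)` (`sqrt_neg_log_gaussianReal_sub_le`). Summed over the messages of one machine, this
  bounds the squared Hellinger distance between the laws of its message under means at distance `d`
  by a multiple of `d² / σ²` times the entropies of the message
  (`one_sub_le_sum_sqrt_messageProb`). Entropies add up over the machines and Hellinger affinities
  multiply, so if `d²` is a small multiple of `σ² / D`, transcripts of entropy `O(D)` cannot
  distinguish two means at distance `d`.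

Applied to the grid and to its shift by `d`, these give an average risk of order `d²`
(`le_sum_transcriptRisk_grid`).
-/

/-! ### Log-convexity of Gaussian probabilities in the mean -/

theorem gaussianPDFReal_rpow_mul_rpow {a b s t : ℝ} (v : NNReal) (hv : v ≠ 0) (hst : s + t = 1)
    (x : ℝ) :
    gaussianPDFReal a v x ^ s * gaussianPDFReal b v x ^ t =
      Real.exp (-(s * t * (a - b) ^ 2 / (2 * v))) * gaussianPDFReal (s * a + t * b) v x := by
  have hv' : (v : ℝ) ≠ 0 := by exact_mod_cast hv
  have hc : 0 < (√(2 * Real.pi * v))⁻¹ := by positivity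
  simp only [gaussianPDFReal]
  rw [Real.mul_rpow hc.le (Real.exp_nonneg _), Real.mul_rpow hc.le (Real.exp_nonneg _),
    ← Real.exp_mul, ← Real.exp_mul, mul_mul_mul_comm, ← Real.rpow_add hc, hst, Real.rpow_one,
    ← Real.exp_add, mul_left_comm, ← Real.exp_add]
  congr 2
  obtain rfl : t = 1 - s := by linarith
  field_simp
  ring

/-- The function `t ↦ exp (t² / (2v)) * N(t, v)(A)` is log-convex. This is Hölder's inequality for
the Gaussian densities. -/
theorem exp_mul_gaussianReal_le_rpow_mul_rpow {a b s t : ℝ} {v : NNReal} (hv : v ≠ 0)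
    (hs : 0 ≤ s) (ht : 0 ≤ t) (hst : s + t = 1) (A : Set ℝ) :
    Real.exp (-(s * t * (a - b) ^ 2 / (2 * v))) * (gaussianReal (s * a + t * b) v).real A ≤
      (gaussianReal a v).real A ^ s * (gaussianReal b v).real A ^ t := by
  have key : ENNReal.ofReal (Real.exp (-(s * t * (a - b) ^ 2 / (2 * v)))) *
      gaussianReal (s * a + t * b) v A ≤ gaussianReal a v A ^ s * gaussianReal b v A ^ t := by
    rw [gaussianReal_apply _ hv, gaussianReal_apply _ hv, gaussianReal_apply _ hv,
      ← lintegral_const_mul _ (measurable_gaussianPDF _ _)]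
    refine le_trans (le_of_eq ?_) (ENNReal.lintegral_mul_norm_pow_le
      (measurable_gaussianPDF a v).aemeasurable (measurable_gaussianPDF b v).aemeasurable
      hs ht hst)
    refine lintegral_congr fun x => ?_
    simp only [gaussianPDF]
    rw [ENNReal.ofReal_rpow_of_nonneg (gaussianPDFReal_nonneg _ _ _) hs,
      ENNReal.ofReal_rpow_of_nonneg (gaussianPDFReal_nonneg _ _ _) ht,
      ← ENNReal.ofReal_mul (Real.rpow_nonneg (gaussianPDFReal_nonneg _ _ _) _),
      ← ENNReal.ofReal_mul (Real.exp_nonneg _), gaussianPDFReal_rpow_mul_rpow v hv hst]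
  have h := ENNReal.toReal_mono (by finiteness) key
  simpa [measureReal_def, ENNReal.toReal_mul, ENNReal.toReal_rpow, ENNReal.toReal_ofReal,
    Real.exp_nonneg] using h

/-- Hellinger affinity of the probabilities of one event under two Gaussian means. -/
theorem exp_mul_gaussianReal_midpoint_le_sqrt {a b : ℝ} {v : NNReal} (hv : v ≠ 0) (A : Set ℝ) :
    Real.exp (-((a - b) ^ 2 / (8 * v))) * (gaussianReal ((a + b) / 2) v).real A ≤
      √((gaussianReal a v).real A * (gaussianReal b v).real A) := by
  have h := exp_mul_gaussianReal_le_rpow_mul_rpow (a := a) (b := b) (s := 1 / 2) (t := 1 / 2) hv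
    (by norm_num) (by norm_num) (by norm_num) A
  rw [← Real.mul_rpow measureReal_nonneg measureReal_nonneg, ← Real.sqrt_eq_rpow] at h
  convert h using 3
  · ring_nf
  · congr 1; ring

/-- Moving the mean by `d` changes `√(-log N(·, v)(A))` by at most `|d| / √(2v)`. -/
theorem sqrt_neg_log_gaussianReal_sub_le {a d : ℝ} {v : NNReal} (hv : v ≠ 0) {A : Set ℝ}
    (hA : 0 < (gaussianReal (a + d) v).real A) {ε : ℝ} (hε : 0 < ε)
    (hεd : ε ^ 2 = d ^ 2 / (2 * v)) :
    √(-Real.log ((gaussianReal a v).real A)) - √(-Real.log ((gaussianReal (a + d) v).real A)) ≤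
      ε := by
  set x := √(-Real.log ((gaussianReal a v).real A)) with hx
  set y := √(-Real.log ((gaussianReal (a + d) v).real A)) with hy
  have hy0 : 0 ≤ y := Real.sqrt_nonneg _
  rcases le_or_gt x ε with hxε | hxε
  · linarith
  have hx0 : 0 < x := hε.trans hxε
  have hlogp : Real.log ((gaussianReal a v).real A) = -x ^ 2 := by
    rw [hx, Real.sq_sqrt (Real.sqrt_pos.mp hx0).le]; ring
  have hp : 0 < (gaussianReal a v).real A := by
    refine measureReal_nonneg.lt_of_ne' fun h0 => ?_
    rw [h0, Real.log_zero] at hlogp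
    nlinarith
  have hlogq : Real.log ((gaussianReal (a + d) v).real A) = -y ^ 2 := by
    rw [hy, Real.sq_sqrt (neg_nonneg.mpr (Real.log_nonpos measureReal_nonneg
      measureReal_le_one))]; ring
  -- The third mean `a + (x / ε) d`, for which the event has probability at most one, is optimal.
  have h := exp_mul_gaussianReal_le_rpow_mul_rpow (a := a) (b := a + x / ε * d)
    (s := 1 - ε / x) (t := ε / x) hv (by rw [sub_nonneg, div_le_one hx0]; exact hxε.le)
    (by positivity) (by ring) A
  have hmean : (1 - ε / x) * a + ε / x * (a + x / ε * d) = a + d := by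
    field_simp; ring
  have hexp : (1 - ε / x) * (ε / x) * (a - (a + x / ε * d)) ^ 2 / (2 * v) = (x - ε) * ε := by
    have : (1 - ε / x) * (ε / x) * (a - (a + x / ε * d)) ^ 2 / (2 * v) =
        (1 - ε / x) * (x / ε) * (d ^ 2 / (2 * v)) := by
      field_simp; ring
    rw [this, ← hεd]; field_simp
  rw [hmean, hexp] at h
  have h1 : Real.exp (-((x - ε) * ε)) * (gaussianReal (a + d) v).real A ≤
      (gaussianReal a v).real A ^ (1 - ε / x) :=
    h.trans (mul_le_of_le_one_right (by positivity)
      (Real.rpow_le_one measureReal_nonneg measureReal_le_one (by positivity)))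
  have h2 := Real.log_le_log (by positivity) h1
  rw [Real.log_mul (Real.exp_ne_zero _) hA.ne', Real.log_exp, Real.log_rpow hp, hlogp, hlogq] at h2
  have h3 : (1 - ε / x) * -x ^ 2 = -(x * (x - ε)) := by field_simp
  rw [h3] at h2
  have h4 : (x - ε) ^ 2 ≤ y ^ 2 := by nlinarith
  linarith [(le_abs_self _).trans (abs_le_of_sq_le_sq h4 hy0)]

/-! ### Hellinger distance of quantized Gaussians -/

theorem sq_exp_sub_exp_le_of_le {x y ε : ℝ} (hx : 0 ≤ x) (hxy : x ≤ y) (hε : y - x ≤ ε)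
    (hε1 : ε ≤ 1) :
    (Real.exp (-x ^ 2 / 2) - Real.exp (-y ^ 2 / 2)) ^ 2 ≤
      Real.exp 4 * ε ^ 2 * (x ^ 2 * Real.exp (-x ^ 2) + y ^ 2 * Real.exp (-y ^ 2)) := by
  have hε0 : 0 ≤ ε := by linarith
  have hmono : Real.exp (-y ^ 2 / 2) ≤ Real.exp (-x ^ 2 / 2) := by
    gcongr
  have h1 : Real.exp (-x ^ 2 / 2) - Real.exp (-y ^ 2 / 2) ≤ Real.exp (-x ^ 2 / 2) * (ε * y) := by
    have e : Real.exp (-y ^ 2 / 2) = Real.exp (-x ^ 2 / 2) * Real.exp (-(y ^ 2 - x ^ 2) / 2) := by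
      rw [← Real.exp_add]; ring_nf
    rw [e]
    have h2 := Real.add_one_le_exp (-(y ^ 2 - x ^ 2) / 2)
    have h3 : (y ^ 2 - x ^ 2) / 2 ≤ ε * y := by nlinarith
    nlinarith [Real.exp_pos (-x ^ 2 / 2)]
  have h2 : (Real.exp (-x ^ 2 / 2) - Real.exp (-y ^ 2 / 2)) ^ 2 ≤
      ε ^ 2 * (y ^ 2 * Real.exp (-x ^ 2)) := by
    refine (pow_le_pow_left₀ (by linarith) h1 2).trans (le_of_eq ?_)
    rw [mul_pow, ← Real.exp_nat_mul, mul_pow]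
    ring_nf
  refine h2.trans ?_
  rw [mul_comm (Real.exp 4), mul_assoc]
  refine mul_le_mul_of_nonneg_left ?_ (sq_nonneg ε)
  rcases le_total y 2 with hy | hy
  · have h3 : Real.exp (-x ^ 2) ≤ Real.exp 4 * Real.exp (-y ^ 2) := by
      rw [← Real.exp_add]
      gcongr
      nlinarith
    calc y ^ 2 * Real.exp (-x ^ 2) ≤ y ^ 2 * (Real.exp 4 * Real.exp (-y ^ 2)) := by gcongr
      _ = Real.exp 4 * (y ^ 2 * Real.exp (-y ^ 2)) := by ring
      _ ≤ _ := by gcongr; exact le_add_of_nonneg_left (by positivity)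
  · have h4 : (4 : ℝ) ≤ Real.exp 4 := by linarith [Real.add_one_le_exp (4 : ℝ)]
    have h5 : y ^ 2 ≤ 4 * x ^ 2 := by nlinarith
    calc y ^ 2 * Real.exp (-x ^ 2) ≤ 4 * x ^ 2 * Real.exp (-x ^ 2) := by gcongr
      _ = 4 * (x ^ 2 * Real.exp (-x ^ 2)) := by ring
      _ ≤ Real.exp 4 * (x ^ 2 * Real.exp (-x ^ 2)) := by gcongr
      _ ≤ _ := by gcongr; exact le_add_of_nonneg_right (by positivity)

theorem sq_exp_sub_exp_le {x y ε : ℝ} (hx : 0 ≤ x) (hy : 0 ≤ y) (hxy : x - y ≤ ε)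
    (hyx : y - x ≤ ε) (hε1 : ε ≤ 1) :
    (Real.exp (-x ^ 2 / 2) - Real.exp (-y ^ 2 / 2)) ^ 2 ≤
      Real.exp 4 * ε ^ 2 * (x ^ 2 * Real.exp (-x ^ 2) + y ^ 2 * Real.exp (-y ^ 2)) := by
  rcases le_total x y with h | h
  · exact sq_exp_sub_exp_le_of_le hx h hyx hε1
  · rw [sub_sq_comm, add_comm]
    exact sq_exp_sub_exp_le_of_le hy h hxy hε1

/-- One term of the squared Hellinger distance is controlled by the corresponding entropy terms.
The bound is linear in the entropy, so cells of probability near one cost almost nothing. -/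
theorem sq_sqrt_gaussianReal_sub_sqrt_le {a d : ℝ} {v : NNReal} (hv : v ≠ 0) (A : Set ℝ)
    (hd : d ^ 2 / (2 * v) ≤ 1) :
    (√((gaussianReal a v).real A) - √((gaussianReal (a + d) v).real A)) ^ 2 ≤
      Real.exp 4 * (d ^ 2 / (2 * v)) * (Real.negMulLog ((gaussianReal a v).real A) +
        Real.negMulLog ((gaussianReal (a + d) v).real A)) := by
  rcases eq_or_ne d 0 with rfl | hd0
  · simp
  have hv' : (0 : ℝ) < v := by exact_mod_cast pos_iff_ne_zero.mpr hv
  set ε := √(d ^ 2 / (2 * v)) with hε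
  have hε2 : ε ^ 2 = d ^ 2 / (2 * v) := Real.sq_sqrt (by positivity)
  have hε0 : 0 < ε := Real.sqrt_pos.mpr (by positivity)
  have hε1 : ε ≤ 1 := Real.sqrt_le_one.mpr hd
  -- Gaussian measures with the same variance have the same null sets.
  have hac : ∀ x y : ℝ, (gaussianReal x v).real A = 0 → (gaussianReal y v).real A = 0 := by
    intro x y h
    rw [measureReal_eq_zero_iff] at h ⊢
    exact (gaussianReal_absolutelyContinuous y hv) ((gaussianReal_absolutelyContinuous' x hv) h)
  by_cases h0 : (gaussianReal a v).real A = 0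
  · rw [h0, hac _ (a + d) h0]; simp
  have h0' : (gaussianReal (a + d) v).real A ≠ 0 := fun h => h0 (hac _ _ h)
  have hp := measureReal_nonneg.lt_of_ne' h0
  have hq := measureReal_nonneg.lt_of_ne' h0'
  have hxy := sqrt_neg_log_gaussianReal_sub_le hv hq hε0 hε2
  have hyx := sqrt_neg_log_gaussianReal_sub_le (a := a + d) (d := -d) hv (A := A) (by simpa using hp)
    hε0 (by rw [hε2]; ring)
  rw [add_neg_cancel_right] at hyx
  have hsq : ∀ x : ℝ, √(-Real.log ((gaussianReal x v).real A)) ^ 2 =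
      -Real.log ((gaussianReal x v).real A) := fun x =>
    Real.sq_sqrt (neg_nonneg.mpr (Real.log_nonpos measureReal_nonneg measureReal_le_one))
  have h := sq_exp_sub_exp_le (Real.sqrt_nonneg _) (Real.sqrt_nonneg _) hxy hyx hε1
  rw [hsq, hsq, neg_neg, neg_neg, Real.exp_log hp, Real.exp_log hq, Real.exp_half, Real.exp_half,
    Real.exp_log hp, Real.exp_log hq, hε2] at h
  refine h.trans (le_of_eq ?_)
  simp only [Real.negMulLog]
  ring

/-! ### Inequalities for finite distributions -/

theorem one_sub_sum_le_prod {ι : Type*} (s : Finset ι) (f x : ι → ℝ)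
    (hf0 : ∀ i ∈ s, 0 ≤ f i) (hf1 : ∀ i ∈ s, f i ≤ 1) (hx : ∀ i ∈ s, 1 - x i ≤ f i) :
    1 - ∑ i ∈ s, x i ≤ ∏ i ∈ s, f i := by
  classical
  induction s using Finset.induction_on with
  | empty => simp
  | insert a s ha ih =>
    rw [Finset.sum_insert ha, Finset.prod_insert ha]
    simp only [Finset.mem_insert, forall_eq_or_imp] at hf0 hf1 hx
    have h1 := ih hf0.2 hf1.2 hx.2
    have h2 : ∏ i ∈ s, f i ≤ 1 := Finset.prod_le_one hf0.2 hf1.2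
    have h3 : (0 : ℝ) ≤ ∏ i ∈ s, f i := Finset.prod_nonneg hf0.2
    nlinarith

theorem negMulLog_prod {ι : Type*} [DecidableEq ι] (s : Finset ι) (x : ι → ℝ) :
    Real.negMulLog (∏ i ∈ s, x i) =
      ∑ i ∈ s, ∏ j ∈ s, if j = i then Real.negMulLog (x j) else x j := by
  induction s using Finset.induction_on with
  | empty => simp
  | insert a s ha ih =>
    rw [Finset.prod_insert ha, Real.negMulLog_mul, ih, Finset.sum_insert ha, Finset.prod_insert ha,
      if_pos rfl, mul_comm, Finset.mul_sum]
    congr 1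
    · congr 1
      exact Finset.prod_congr rfl fun j hj => (if_neg (ne_of_mem_of_not_mem hj ha)).symm
    · refine Finset.sum_congr rfl fun i hi => ?_
      rw [Finset.prod_insert ha, if_neg (ne_of_mem_of_not_mem hi ha).symm]

/-- Additivity of entropy for independent coordinates. -/
theorem sum_negMulLog_prod {ι : Type*} [Fintype ι] [DecidableEq ι] {α : ι → Type*}
    [∀ i, Fintype (α i)] (p : ∀ i, α i → ℝ) (hp : ∀ i, ∑ z, p i z = 1) :
    ∑ z : ∀ i, α i, Real.negMulLog (∏ i, p i (z i)) = ∑ i, ∑ z, Real.negMulLog (p i z) := by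
  simp_rw [negMulLog_prod]
  rw [Finset.sum_comm]
  refine Finset.sum_congr rfl fun i _ => ?_
  rw [← Fintype.prod_sum fun j z => if j = i then Real.negMulLog (p j z) else p j z,
    Finset.prod_eq_single i (fun j _ hj => by simp [hj, hp]) (by simp)]
  simp

/-- Gibbs' inequality with an unnormalized weight. -/
theorem negMulLog_le_neg_mul_log_add {p w : ℝ} (hp : 0 ≤ p) (hw : 0 < w) :
    Real.negMulLog p ≤ -(p * Real.log w) + w - p := by
  rcases hp.eq_or_lt with rfl | hp
  · simp [hw.le]
  have h := Real.log_le_sub_one_of_pos (div_pos hw hp)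
  rw [Real.log_div hw.ne' hp.ne'] at h
  have h2 : p * (Real.log w - Real.log p) ≤ w - p := by
    calc p * (Real.log w - Real.log p) ≤ p * (w / p - 1) := by gcongr
      _ = w - p := by field_simp
  rw [Real.negMulLog]
  linarith

/-- Le Cam's two-point bound for quadratic loss, in terms of the Hellinger affinity. -/
theorem sq_mul_sq_sum_sqrt_le {Z : Type*} [Fintype Z] (p q : Z → ℝ) (hp : ∀ z, 0 ≤ p z)
    (hq : ∀ z, 0 ≤ q z) (hp1 : ∑ z, p z = 1) (hq1 : ∑ z, q z = 1) (e : Z → ℝ) (a d : ℝ) :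
    d ^ 2 / 2 * (∑ z, √(p z * q z)) ^ 2 ≤
      ∑ z, p z * (e z - a) ^ 2 + ∑ z, q z * (e z - (a + d)) ^ 2 := by
  have h1 : (∑ z, (√(p z) * (e z - a)) * √(q z)) ^ 2 ≤ ∑ z, p z * (e z - a) ^ 2 := by
    refine (Finset.sum_mul_sq_le_sq_mul_sq _ _ _).trans (le_of_eq ?_)
    simp_rw [mul_pow, Real.sq_sqrt (hp _), Real.sq_sqrt (hq _), hq1, mul_one]
  have h2 : (∑ z, (√(q z) * (e z - (a + d))) * √(p z)) ^ 2 ≤ ∑ z, q z * (e z - (a + d)) ^ 2 := by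
    refine (Finset.sum_mul_sq_le_sq_mul_sq _ _ _).trans (le_of_eq ?_)
    simp_rw [mul_pow, Real.sq_sqrt (hp _), Real.sq_sqrt (hq _), hp1, mul_one]
  have h3 : d * ∑ z, √(p z * q z) = ∑ z, (√(p z) * (e z - a)) * √(q z) -
      ∑ z, (√(q z) * (e z - (a + d))) * √(p z) := by
    rw [Finset.mul_sum, ← Finset.sum_sub_distrib]
    refine Finset.sum_congr rfl fun z _ => ?_
    rw [Real.sqrt_mul (hp z)]; ring
  have h4 : d ^ 2 / 2 * (∑ z, √(p z * q z)) ^ 2 = (d * ∑ z, √(p z * q z)) ^ 2 / 2 := by ring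
  rw [h4, h3]
  set x := ∑ z, (√(p z) * (e z - a)) * √(q z)
  set y := ∑ z, (√(q z) * (e z - (a + d))) * √(p z)
  nlinarith [sq_nonneg (x + y)]

theorem sum_half_pow_natAbs_sub_le (s : Finset ℕ) (j : ℤ) :
    ∑ k ∈ s, (1 / 2 : ℝ) ^ ((k : ℤ) - j).natAbs ≤ 3 := by
  have hg : HasSum (fun n : ℕ => (1 / 2 : ℝ) ^ n) 2 := by
    simpa using hasSum_geometric_two
  have hg' : HasSum (fun n : ℕ => (1 / 2 : ℝ) ^ (n + 1)) 1 := by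
    have := hg.mul_right (1 / 2)
    norm_num at this
    simpa [pow_succ] using this
  have h : HasSum (fun n : ℤ => (1 / 2 : ℝ) ^ n.natAbs) (2 + 1) := by
    refine HasSum.of_nat_of_neg_add_one (by simpa using hg) ?_
    convert hg' using 3 with n
    omega
  have hinj : Set.InjOn (fun k : ℕ => (k : ℤ) - j) s := fun x _ y _ hxy => by
    simpa using hxy
  rw [← Finset.sum_image (g := fun k : ℕ => (k : ℤ) - j) (f := fun n : ℤ => (1 / 2 : ℝ) ^ n.natAbs)
    hinj]
  refine (h.summable.sum_le_tsum _ fun n _ => by positivity).trans ?_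
  rw [h.tsum_eq]; norm_num

/-! ### Transcript distributions -/

/-- The probability that the quantizer `T` sends the message `z` when the observation has law
`N(θ, v)`. -/
noncomputable def messageProb {α : Type*} (T : ℝ → α) (v : NNReal) (θ : ℝ) (z : α) : ℝ :=
  (gaussianReal θ v).real (T ⁻¹' {z})

/-- The probability of the vector of messages `z` when the observations are independent with law
`N(θ, v)` and machine `i` uses the quantizer `T i`. -/
noncomputable def transcriptProb {m : ℕ} {α : Fin m → Type*} (T : ∀ i, ℝ → α i) (v : NNReal)
    (θ : ℝ) (z : ∀ i, α i) : ℝ :=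
  ∏ i, messageProb (T i) v θ (z i)

/-- The mean squared error of the nonrandomized protocol with quantizers `T` and estimator `e`. -/
noncomputable def transcriptRisk {m : ℕ} {α : Fin m → Type*} [∀ i, Fintype (α i)]
    (T : ∀ i, ℝ → α i) (e : (∀ i, α i) → ℝ) (v : NNReal) (θ : ℝ) : ℝ :=
  ∑ z, transcriptProb T v θ z * (e z - θ) ^ 2

theorem messageProb_nonneg {α : Type*} {T : ℝ → α} {v : NNReal} (θ : ℝ) (z : α) :
    0 ≤ messageProb T v θ z := measureReal_nonneg

section Message

variable {α : Type*} [Fintype α] [MeasurableSpace α] [MeasurableSingletonClass α] {T : ℝ → α}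
  {v : NNReal}

theorem sum_messageProb (hT : Measurable T) (θ : ℝ) : ∑ z, messageProb T v θ z = 1 := by
  have h := sum_measureReal_preimage_singleton (μ := gaussianReal θ v) (f := T) Finset.univ
    (fun y _ => hT (measurableSet_singleton y))
  simpa [messageProb] using h

theorem sum_sqrt_messageProb_le_one (hT : Measurable T) (a b : ℝ) :
    ∑ z, √(messageProb T v a z * messageProb T v b z) ≤ 1 := by
  have h : ∀ z, √(messageProb T v a z * messageProb T v b z) ≤
      (messageProb T v a z + messageProb T v b z) / 2 := fun z => by
    have ha := messageProb_nonneg (T := T) (v := v) a z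
    have hb := messageProb_nonneg (T := T) (v := v) b z
    refine Real.sqrt_le_iff.mpr ⟨by positivity, ?_⟩
    nlinarith [sq_nonneg (messageProb T v a z - messageProb T v b z)]
  refine (Finset.sum_le_sum fun z _ => h z).trans ?_
  rw [← Finset.sum_div, Finset.sum_add_distrib, sum_messageProb hT, sum_messageProb hT]
  norm_num

theorem exp_le_sum_sqrt_messageProb (hv : v ≠ 0) (hT : Measurable T) (a d : ℝ) :
    Real.exp (-(d ^ 2 / (8 * v))) ≤ ∑ z, √(messageProb T v a z * messageProb T v (a + d) z) := by
  calc Real.exp (-(d ^ 2 / (8 * v)))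
      = ∑ z, Real.exp (-(d ^ 2 / (8 * v))) * messageProb T v ((a + (a + d)) / 2) z := by
        rw [← Finset.mul_sum, sum_messageProb hT, mul_one]
    _ ≤ _ := by
        refine Finset.sum_le_sum fun z _ => ?_
        have h := exp_mul_gaussianReal_midpoint_le_sqrt (a := a) (b := a + d) hv (T ⁻¹' {z})
        rwa [sub_add_cancel_left, neg_sq] at h

/-- The data-processing inequality for one machine: the Hellinger information of its message about
a shift of the mean by `d` is at most a constant times `d² / v` times the entropy of the message. -/
theorem one_sub_le_sum_sqrt_messageProb (hv : v ≠ 0) (hT : Measurable T) (a : ℝ) {d : ℝ}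
    (hd : d ^ 2 / (2 * v) ≤ 1) :
    1 - Real.exp 4 * (d ^ 2 / (2 * v)) / 2 * (∑ z, Real.negMulLog (messageProb T v a z) +
      ∑ z, Real.negMulLog (messageProb T v (a + d) z)) ≤
      ∑ z, √(messageProb T v a z * messageProb T v (a + d) z) := by
  have h : ∀ z, (messageProb T v a z + messageProb T v (a + d) z) / 2 -
      Real.exp 4 * (d ^ 2 / (2 * v)) / 2 * (Real.negMulLog (messageProb T v a z) +
        Real.negMulLog (messageProb T v (a + d) z)) ≤
      √(messageProb T v a z * messageProb T v (a + d) z) := fun z => by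
    have h1 := sq_sqrt_gaussianReal_sub_sqrt_le (a := a) hv (T ⁻¹' {z}) hd
    have h2 := Real.sq_sqrt (messageProb_nonneg (T := T) (v := v) a z)
    have h3 := Real.sq_sqrt (messageProb_nonneg (T := T) (v := v) (a + d) z)
    rw [Real.sqrt_mul (messageProb_nonneg a z)]
    simp only [messageProb] at *
    nlinarith
  have hs := Finset.sum_le_sum fun z (_ : z ∈ Finset.univ) => h z
  rw [Finset.sum_sub_distrib, ← Finset.sum_div, Finset.sum_add_distrib, sum_messageProb hT,
    sum_messageProb hT, ← Finset.mul_sum, Finset.sum_add_distrib] at hs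
  linarith

end Message

section Transcript

variable {m : ℕ} {α : Fin m → Type*} {T : ∀ i, ℝ → α i} {v : NNReal}

theorem transcriptProb_nonneg (θ : ℝ) (z : ∀ i, α i) : 0 ≤ transcriptProb T v θ z :=
  Finset.prod_nonneg fun _ _ => messageProb_nonneg _ _

variable [∀ i, Fintype (α i)]

theorem transcriptRisk_nonneg (e : (∀ i, α i) → ℝ) (θ : ℝ) : 0 ≤ transcriptRisk T e v θ :=
  Finset.sum_nonneg fun _ _ => mul_nonneg (transcriptProb_nonneg _ _) (sq_nonneg _)

theorem sum_sqrt_transcriptProb (a b : ℝ) :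
    ∑ z, √(transcriptProb T v a z * transcriptProb T v b z) =
      ∏ i, ∑ z, √(messageProb (T i) v a z * messageProb (T i) v b z) := by
  rw [Fintype.prod_sum]
  refine Finset.sum_congr rfl fun z _ => ?_
  rw [transcriptProb, transcriptProb, ← Finset.prod_mul_distrib, Real.sqrt_prod]
  exact fun i _ => mul_nonneg (messageProb_nonneg _ _) (messageProb_nonneg _ _)

variable [∀ i, MeasurableSpace (α i)] [∀ i, MeasurableSingletonClass (α i)]

theorem sum_transcriptProb (hT : ∀ i, Measurable (T i)) (θ : ℝ) :
    ∑ z, transcriptProb T v θ z = 1 := by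
  simp only [transcriptProb]
  rw [← Fintype.prod_sum fun i z => messageProb (T i) v θ z]
  exact Finset.prod_eq_one fun i _ => sum_messageProb (hT i) θ

theorem sum_negMulLog_transcriptProb (hT : ∀ i, Measurable (T i)) (θ : ℝ) :
    ∑ z, Real.negMulLog (transcriptProb T v θ z) =
      ∑ i, ∑ z, Real.negMulLog (messageProb (T i) v θ z) :=
  sum_negMulLog_prod _ fun i => sum_messageProb (hT i) θ

theorem sq_mul_exp_le_transcriptRisk_add (hv : v ≠ 0) (hT : ∀ i, Measurable (T i))
    (e : (∀ i, α i) → ℝ) (a d : ℝ) :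
    d ^ 2 / 2 * Real.exp (-(m * (d ^ 2 / (4 * v)))) ≤
      transcriptRisk T e v a + transcriptRisk T e v (a + d) := by
  refine le_trans ?_ (sq_mul_sq_sum_sqrt_le _ _ (transcriptProb_nonneg a)
    (transcriptProb_nonneg (a + d)) (sum_transcriptProb hT a) (sum_transcriptProb hT (a + d)) e a d)
  rw [sum_sqrt_transcriptProb]
  have h : Real.exp (-(d ^ 2 / (8 * v))) ^ m ≤
      ∏ i, ∑ z, √(messageProb (T i) v a z * messageProb (T i) v (a + d) z) := by
    have := Finset.prod_le_prod (s := Finset.univ) (f := fun _ : Fin m =>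
      Real.exp (-(d ^ 2 / (8 * v)))) (fun i _ => (Real.exp_pos _).le)
      (fun i _ => exp_le_sum_sqrt_messageProb hv (hT i) a d)
    simpa using this
  calc d ^ 2 / 2 * Real.exp (-(m * (d ^ 2 / (4 * v))))
      = d ^ 2 / 2 * (Real.exp (-(d ^ 2 / (8 * v))) ^ m) ^ 2 := by
        rw [← pow_mul, ← Real.exp_nat_mul]
        congr 2
        push_cast
        ring
    _ ≤ _ := by gcongr

/-- Two means at distance `d` cannot be told apart when the transcript has entropy much smaller
than `v / d²`. -/
theorem sq_mul_one_sub_entropy_le_transcriptRisk_add (hv : v ≠ 0) (hT : ∀ i, Measurable (T i))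
    (e : (∀ i, α i) → ℝ) (a : ℝ) {d : ℝ} (hd : d ^ 2 / (2 * v) ≤ 1) :
    d ^ 2 / 2 * (1 - Real.exp 4 * (d ^ 2 / (2 * v)) *
      (∑ z, Real.negMulLog (transcriptProb T v a z) +
        ∑ z, Real.negMulLog (transcriptProb T v (a + d) z))) ≤
      transcriptRisk T e v a + transcriptRisk T e v (a + d) := by
  refine le_trans ?_ (sq_mul_sq_sum_sqrt_le _ _ (transcriptProb_nonneg a)
    (transcriptProb_nonneg (a + d)) (sum_transcriptProb hT a) (sum_transcriptProb hT (a + d)) e a d)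
  gcongr
  rw [sum_sqrt_transcriptProb, sum_negMulLog_transcriptProb hT, sum_negMulLog_transcriptProb hT]
  have h := one_sub_sum_le_prod Finset.univ
    (fun i => ∑ z, √(messageProb (T i) v a z * messageProb (T i) v (a + d) z)) _
    (fun i _ => Finset.sum_nonneg fun z _ => Real.sqrt_nonneg _)
    (fun i _ => sum_sqrt_messageProb_le_one (hT i) a (a + d))
    (fun i _ => one_sub_le_sum_sqrt_messageProb hv (hT i) a hd)
  rw [← Finset.mul_sum, Finset.sum_add_distrib] at h
  -- `1 - 2 t ≤ x ^ 2` follows from `1 - t ≤ x` by `(1 - x) ^ 2 ≥ 0`.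
  nlinarith [sq_nonneg (1 - ∏ i, ∑ z, √(messageProb (T i) v a z * messageProb (T i) v (a + d) z))]

/-- Localization uses up entropy: on a grid of `N` means with spacing `1 / N`, the average entropy
of the transcript is below its maximum by `log N`, up to a constant and the mean squared error on
the scale of the grid. The weight in Gibbs' inequality decays geometrically away from the grid point
closest to the estimate. -/
theorem sum_entropy_transcriptProb_le (hT : ∀ i, Measurable (T i)) (e : (∀ i, α i) → ℝ) (a : ℝ)
    {N : ℕ} (hN : 0 < N) :
    ∑ k ∈ Finset.range N, ∑ z, Real.negMulLog (transcriptProb T v (a + k / N) z) ≤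
      N * (Real.log (Fintype.card (∀ i, α i)) - Real.log N + Real.log 3 + 1 / 2) +
        2 * N ^ 2 * ∑ k ∈ Finset.range N, transcriptRisk T e v (a + k / N) := by
  have hN' : (0 : ℝ) < N := by exact_mod_cast hN
  have hne : Nonempty (∀ i, α i) := ⟨fun i => T i 0⟩
  set M : ℝ := ((Fintype.card (∀ i, α i) : ℕ) : ℝ) with hM
  have hMpos : 0 < M := by rw [hM]; exact_mod_cast Fintype.card_pos
  let j : (∀ i, α i) → ℤ := fun z => round ((e z - a) * N)
  let w : ℕ → (∀ i, α i) → ℝ := fun k z => N / (3 * M) * (1 / 2) ^ ((k : ℤ) - j z).natAbs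
  have hw : ∀ k z, 0 < w k z := fun k z => by positivity
  have hwsum : ∑ k ∈ Finset.range N, ∑ z, w k z ≤ N := by
    rw [Finset.sum_comm]
    calc ∑ z, ∑ k ∈ Finset.range N, w k z ≤ ∑ _z : ∀ i, α i, N / (3 * M) * 3 := by
          refine Finset.sum_le_sum fun z _ => ?_
          simp only [w]
          rw [← Finset.mul_sum]
          exact mul_le_mul_of_nonneg_left (sum_half_pow_natAbs_sub_le _ _) (by positivity)
      _ = N := by
          rw [Finset.sum_const, Finset.card_univ, nsmul_eq_mul, ← hM]
          field_simp
  have hlog : ∀ k z, -Real.log (w k z) ≤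
      (Real.log M - Real.log N + Real.log 3 + 1 / 2) + 2 * N ^ 2 * (e z - (a + k / N)) ^ 2 := by
    intro k z
    have h1 : Real.log (w k z) = Real.log N - (Real.log 3 + Real.log M) -
        ((k : ℤ) - j z).natAbs * Real.log 2 := by
      simp only [w]
      rw [Real.log_mul (by positivity) (by positivity), Real.log_div (by positivity) (by positivity),
        Real.log_mul (by positivity) (by positivity), Real.log_pow, one_div, Real.log_inv]
      ring
    have h2 : ((((k : ℤ) - j z).natAbs : ℕ) : ℝ) * Real.log 2 ≤ ((k : ℝ) - j z) ^ 2 := by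
      have h3 : ((((k : ℤ) - j z).natAbs : ℕ) : ℝ) ≤ ((((k : ℤ) - j z).natAbs : ℕ) : ℝ) ^ 2 := by
        exact_mod_cast Nat.le_self_pow two_ne_zero _
      have h4 : ((((k : ℤ) - j z).natAbs : ℕ) : ℝ) ^ 2 = ((k : ℝ) - j z) ^ 2 := by
        rw [Nat.cast_natAbs, Int.cast_abs, sq_abs]
        push_cast
        ring
      have h5 : Real.log 2 ≤ 1 := by linarith [Real.log_le_sub_one_of_pos (two_pos (α := ℝ))]
      rw [← h4]
      exact (mul_le_of_le_one_right (Nat.cast_nonneg _) h5).trans h3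
    have h6 := abs_le.mp (abs_sub_round ((e z - a) * N))
    have h7 : ((e z - a) * N - k) ^ 2 = N ^ 2 * (e z - (a + k / N)) ^ 2 := by
      field_simp
      ring
    have h8 : ((k : ℝ) - j z) ^ 2 ≤ 2 * ((e z - a) * N - k) ^ 2 + 1 / 2 := by
      have h9 : ((e z - a) * N - round ((e z - a) * N)) ^ 2 ≤ 1 / 4 := by nlinarith [h6.1, h6.2]
      simp only [j]
      nlinarith [sq_nonneg ((e z - a) * N - round ((e z - a) * N) + ((e z - a) * N - k))]
    rw [h7] at h8
    linarith
  have hterm : ∀ (k : ℕ) z, Real.negMulLog (transcriptProb T v (a + k / N) z) ≤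
      transcriptProb T v (a + k / N) z * (Real.log M - Real.log N + Real.log 3 + 1 / 2) +
        2 * N ^ 2 * (transcriptProb T v (a + k / N) z * (e z - (a + k / N)) ^ 2) +
        w k z - transcriptProb T v (a + k / N) z := by
    intro k z
    have hp := transcriptProb_nonneg (T := T) (v := v) (a + k / N) z
    have h1 := negMulLog_le_neg_mul_log_add hp (hw k z)
    have h2 := mul_le_mul_of_nonneg_left (hlog k z) hp
    linarith
  have hk : ∀ k : ℕ, ∑ z, Real.negMulLog (transcriptProb T v (a + k / N) z) ≤
      (Real.log M - Real.log N + Real.log 3 + 1 / 2) +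
        2 * N ^ 2 * transcriptRisk T e v (a + k / N) + ∑ z, w k z - 1 := by
    intro k
    refine (Finset.sum_le_sum fun z _ => hterm k z).trans (le_of_eq ?_)
    rw [Finset.sum_sub_distrib, Finset.sum_add_distrib, Finset.sum_add_distrib, ← Finset.sum_mul,
      ← Finset.mul_sum, sum_transcriptProb hT, one_mul, transcriptRisk]
  refine (Finset.sum_le_sum fun k _ => hk k).trans ?_
  rw [Finset.sum_sub_distrib, Finset.sum_add_distrib, Finset.sum_add_distrib, ← Finset.mul_sum]
  simp only [Finset.sum_const, Finset.card_range, nsmul_eq_mul, mul_one]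
  linarith

end Transcript

/-! ### Reduction to nonrandomized protocols -/

theorem lintegral_estimate_eq_transcriptRisk {m : ℕ} {α : Fin m → Type*} [∀ i, Fintype (α i)]
    [∀ i, MeasurableSpace (α i)] [∀ i, MeasurableSingletonClass (α i)] {T : ∀ i, ℝ → α i}
    (hT : ∀ i, Measurable (T i)) (e : (∀ i, α i) → ℝ) (v : NNReal) (θ : ℝ) :
    ∫⁻ x : Fin m → ℝ, ENNReal.ofReal ((e (fun i => T i (x i)) - θ) ^ 2)
      ∂(Measure.pi fun _ : Fin m => gaussianReal θ v) =
      ENNReal.ofReal (transcriptRisk T e v θ) := by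
  have hZ : Measurable fun (x : Fin m → ℝ) i => T i (x i) := by fun_prop
  have hF : Measurable fun z : ∀ i, α i => ENNReal.ofReal ((e z - θ) ^ 2) := measurable_of_finite _
  rw [← lintegral_map hF hZ, lintegral_fintype, transcriptRisk, ENNReal.ofReal_sum_of_nonneg
    fun z _ => mul_nonneg (transcriptProb_nonneg _ _) (sq_nonneg _)]
  refine Finset.sum_congr rfl fun z _ => ?_
  have hpre : (fun (x : Fin m → ℝ) i => T i (x i)) ⁻¹' {z} =
      Set.univ.pi fun i => T i ⁻¹' {z i} := by
    ext x; simp [funext_iff]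
  rw [Measure.map_apply hZ (measurableSet_singleton z), hpre, Measure.pi_pi,
    ENNReal.ofReal_mul (transcriptProb_nonneg _ _), mul_comm, transcriptProb,
    ENNReal.ofReal_prod_of_nonneg fun i _ => messageProb_nonneg _ _]
  congr 1
  exact Finset.prod_congr rfl fun i _ => by rw [messageProb, ofReal_measureReal]

/-- A lower bound for the average risk of every nonrandomized protocol over finitely many means is a
lower bound for the minimax risk: conditionally on the seed, a protocol is nonrandomized. -/
theorem ofReal_le_distributedMinimaxRisk {m : ℕ} {b : Fin m → ℕ} {σ : ℝ} {ι : Type*} (s : Finset ι)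
    (hs : s.Nonempty) (θ : ι → ℝ) (hθ : ∀ j ∈ s, θ j ∈ Set.Icc (0 : ℝ) 1) {K : ℝ}
    (h : ∀ T : (i : Fin m) → ℝ → (Fin (b i) → Bool), (∀ i, Measurable (T i)) →
      ∀ e : ((i : Fin m) → Fin (b i) → Bool) → ℝ,
        s.card * K ≤ ∑ j ∈ s, transcriptRisk T e (σ ^ 2).toNNReal (θ j)) :
    ENNReal.ofReal K ≤ distributedMinimaxRisk b σ := by
  refine le_iInf fun A => ?_
  let _ := A.seedSpace
  have := A.law_prob
  have hmeas : Measurable fun p : A.Seed × (Fin m → ℝ) => A.estimate p.1 p.2 := by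
    have h1 : Measurable fun q : A.Seed × ((i : Fin m) → Fin (b i) → Bool) =>
        A.estimator q.1 q.2 :=
      measurable_from_prod_countable_left fun z => A.measurable_estimator z
    have h2 : Measurable fun p : A.Seed × (Fin m → ℝ) =>
        (p.1, fun i => A.transcript i p.1 (p.2 i)) := by
      refine measurable_fst.prodMk (measurable_pi_lambda _ fun i => ?_)
      exact (A.measurable_transcript i).comp
        (measurable_fst.prodMk ((measurable_pi_apply i).comp measurable_snd))
    exact h1.comp h2
  have hT : ∀ s i, Measurable (A.transcript i s) := fun s i =>
    (A.measurable_transcript i).comp measurable_prodMk_left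
  have hmeas2 : ∀ t : ℝ, Measurable fun p : A.Seed × (Fin m → ℝ) =>
      ENNReal.ofReal ((A.estimate p.1 p.2 - t) ^ 2) := fun t =>
    ((hmeas.sub_const t).pow_const 2).ennreal_ofReal
  have hmse : ∀ t : ℝ, A.mse σ t = ∫⁻ r, ENNReal.ofReal (transcriptRisk
      (fun i => A.transcript i r) (A.estimator r) (σ ^ 2).toNNReal t) ∂A.law := by
    intro t
    rw [DistributedProtocol.mse, lintegral_prod _ (hmeas2 t).aemeasurable]
    exact lintegral_congr fun r =>
      lintegral_estimate_eq_transcriptRisk (hT r) (A.estimator r) _ t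
  have hmeas3 : ∀ t : ℝ, Measurable fun r => ENNReal.ofReal (transcriptRisk
      (fun i => A.transcript i r) (A.estimator r) (σ ^ 2).toNNReal t) := by
    intro t
    have := (hmeas2 t).lintegral_prod_right'
      (ν := Measure.pi fun _ : Fin m => gaussianReal t (σ ^ 2).toNNReal)
    convert this using 2 with r
    exact (lintegral_estimate_eq_transcriptRisk (hT r) (A.estimator r) _ t).symm
  have hsum : (s.card : ℝ≥0∞) * ENNReal.ofReal K ≤ ∑ j ∈ s, A.mse σ (θ j) := by
    simp_rw [hmse]
    rw [← lintegral_finsetSum _ fun j _ => hmeas3 (θ j)]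
    calc (s.card : ℝ≥0∞) * ENNReal.ofReal K
        = ∫⁻ _, (s.card : ℝ≥0∞) * ENNReal.ofReal K ∂A.law := by simp
      _ ≤ _ := by
        refine lintegral_mono fun r => ?_
        rw [← ENNReal.ofReal_sum_of_nonneg fun j _ => transcriptRisk_nonneg _ _,
          ← ENNReal.ofReal_natCast, ← ENNReal.ofReal_mul (Nat.cast_nonneg _)]
        exact ENNReal.ofReal_le_ofReal (h _ (hT r) _)
  have hsup : ∑ j ∈ s, A.mse σ (θ j) ≤ s.card * ⨆ t ∈ Set.Icc (0 : ℝ) 1, A.mse σ t := by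
    rw [← nsmul_eq_mul]
    exact Finset.sum_le_card_nsmul _ _ _ fun j hj => le_iSup₂ (f := fun t _ => A.mse σ t) _ (hθ j hj)
  exact (ENNReal.mul_le_mul_iff_right (by simpa using hs.ne_empty) (by simp)).mp (hsum.trans hsup)

theorem card_transcript {m : ℕ} (b : Fin m → ℕ) :
    Fintype.card ((i : Fin m) → Fin (b i) → Bool) = 2 ^ ∑ i, b i := by
  simp [Fintype.card_pi, Finset.prod_pow_eq_pow_sum]

/-! ### Bounds for nonrandomized protocols -/

section Transcript

variable {m : ℕ} {α : Fin m → Type*} [∀ i, Fintype (α i)] [∀ i, MeasurableSpace (α i)]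
  [∀ i, MeasurableSingletonClass (α i)] {T : ∀ i, ℝ → α i} {v : NNReal}

/-- With `M` possible transcripts the estimate takes at most `M` values, so it stays away from at
least half of the means on a grid of `2M` points. -/
theorem le_sum_transcriptRisk_of_card (hT : ∀ i, Measurable (T i)) (e : (∀ i, α i) → ℝ) {M : ℕ}
    (hM : Fintype.card (∀ i, α i) = M) (hM0 : 0 < M) :
    (2 * M : ℕ) * (1 / (32 * (M : ℝ) ^ 2)) ≤
      ∑ j ∈ Finset.range (2 * M), transcriptRisk T e v (j / (2 * M)) := by
  classical
  have hM' : (0 : ℝ) < M := by exact_mod_cast hM0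
  let bad : ℕ → Prop := fun j => ∃ z, |e z - j / (2 * M)| < 1 / (4 * M)
  have hbad : ((Finset.range (2 * M)).filter bad).card ≤ M := by
    have hex : ∀ j, ∃ z, bad j → |e z - j / (2 * M)| < 1 / (4 * M) := fun j => by
      by_cases hj : bad j
      · exact ⟨hj.choose, fun _ => hj.choose_spec⟩
      · exact ⟨fun i => T i 0, fun h => absurd h hj⟩
    choose f hf using hex
    refine le_trans ?_ (Finset.card_univ.trans hM).le
    refine Finset.card_le_card_of_injOn f (fun _ _ => Finset.mem_coe.mpr (Finset.mem_univ _)) ?_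
    intro j hj k hk hjk
    have h1 := hf j (Finset.mem_filter.mp hj).2
    have h2 := hf k (Finset.mem_filter.mp hk).2
    rw [hjk] at h1
    have h3 : |(j : ℝ) / (2 * M) - k / (2 * M)| < 1 / (2 * M) := by
      calc |(j : ℝ) / (2 * M) - k / (2 * M)|
          = |(e (f k) - k / (2 * M)) - (e (f k) - j / (2 * M))| := by ring_nf
        _ ≤ |e (f k) - k / (2 * M)| + |e (f k) - j / (2 * M)| := abs_sub _ _
        _ < 1 / (4 * M) + 1 / (4 * M) := add_lt_add h2 h1
        _ = 1 / (2 * M) := by field_simp; norm_num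
    rw [← sub_div, abs_div, abs_of_pos (by positivity : (0 : ℝ) < 2 * M),
      div_lt_div_iff_of_pos_right (by positivity)] at h3
    have h4 : |(j : ℤ) - k| < 1 := by exact_mod_cast h3
    have := Int.abs_lt_one_iff.mp h4
    omega
  have hgood : ∀ j, ¬ bad j → 1 / (16 * (M : ℝ) ^ 2) ≤ transcriptRisk T e v (j / (2 * M)) := by
    intro j hj
    simp only [bad, not_exists, not_lt] at hj
    calc 1 / (16 * (M : ℝ) ^ 2)
        = ∑ z, transcriptProb T v (j / (2 * M)) z * (1 / (16 * (M : ℝ) ^ 2)) := by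
          rw [← Finset.sum_mul, sum_transcriptProb hT, one_mul]
      _ ≤ _ := by
          refine Finset.sum_le_sum fun z _ =>
            mul_le_mul_of_nonneg_left ?_ (transcriptProb_nonneg _ _)
          rw [← sq_abs (e z - _)]
          refine le_trans (le_of_eq ?_) (pow_le_pow_left₀ (by positivity) (hj z) 2)
          field_simp
          norm_num
  have hcard : (M : ℝ) ≤ ((Finset.range (2 * M)).filter fun j => ¬ bad j).card := by
    have := Finset.card_filter_add_card_filter_not (s := Finset.range (2 * M)) bad
    rw [Finset.card_range] at this
    exact_mod_cast (by omega : M ≤ ((Finset.range (2 * M)).filter fun j => ¬ bad j).card)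
  calc ((2 * M : ℕ) : ℝ) * (1 / (32 * (M : ℝ) ^ 2)) = M * (1 / (16 * (M : ℝ) ^ 2)) := by
        push_cast; field_simp; norm_num
    _ ≤ ((Finset.range (2 * M)).filter fun j => ¬ bad j).card * (1 / (16 * (M : ℝ) ^ 2)) := by
        gcongr
    _ ≤ ∑ j ∈ (Finset.range (2 * M)).filter fun j => ¬ bad j,
          transcriptRisk T e v (j / (2 * M)) := by
        rw [← nsmul_eq_mul]
        exact Finset.card_nsmul_le_sum _ _ _ fun j hj => hgood j (Finset.mem_filter.mp hj).2
    _ ≤ _ := Finset.sum_le_sum_of_subset_of_nonneg (Finset.filter_subset _ _)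
        fun j _ _ => transcriptRisk_nonneg _ _

/-- The trade-off between localization and refinement. If the risk were of smaller order than
`v / D` on both of two grids shifted by `d`, localization would leave the transcripts an entropy of
order `D`, and this is too little to tell the two grids apart. -/
theorem le_sum_transcriptRisk_grid (hv : v ≠ 0) (hT : ∀ i, Measurable (T i))
    (e : (∀ i, α i) → ℝ) {N : ℕ} (hN : 0 < N) (hNv : N ^ 2 * (v : ℝ) ≤ 1) {D d : ℝ} (hD : 2 ≤ D)
    (hcard : Real.log (Fintype.card (∀ i, α i)) - Real.log N ≤ D + 1)
    (hd : d ^ 2 = Real.exp (-4) / 8 * (v / D)) :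
    2 * N * (Real.exp (-4) / 64 * (v / D)) ≤
      ∑ k ∈ Finset.range N, transcriptRisk T e v (k / N) +
        ∑ k ∈ Finset.range N, transcriptRisk T e v (d + k / N) := by
  have hv' : (0 : ℝ) < v := by exact_mod_cast pos_iff_ne_zero.mpr hv
  have hN' : (0 : ℝ) < N := by exact_mod_cast hN
  have hD0 : 0 < D := by linarith
  have hexp : Real.exp (-4) ≤ 1 := Real.exp_le_one_iff.mpr (by norm_num)
  have hexp0 := Real.exp_pos (-4)
  have hvD : 0 < v / D := by positivity
  have hvD' : (v : ℝ) / D ≤ v / 2 := by gcongr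
  have H0 := sum_entropy_transcriptProb_le (v := v) hT e 0 hN
  have H1 := sum_entropy_transcriptProb_le (v := v) hT e d hN
  simp only [zero_add] at H0
  set S0 := ∑ k ∈ Finset.range N, transcriptRisk T e v (k / N)
  set S1 := ∑ k ∈ Finset.range N, transcriptRisk T e v (d + k / N)
  rcases le_or_gt (N * (v : ℝ)) (S0 + S1) with hS | hS
  · refine le_trans ?_ hS
    have : Real.exp (-4) / 64 * (v / D) ≤ 1 * (v / 2) := by gcongr; linarith
    nlinarith
  set E0 := ∑ k ∈ Finset.range N, ∑ z, Real.negMulLog (transcriptProb T v (k / N) z)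
  set E1 := ∑ k ∈ Finset.range N, ∑ z, Real.negMulLog (transcriptProb T v (d + k / N) z)
  have hE : E0 + E1 ≤ 8 * N * D := by
    have h1 : 2 * (N : ℝ) ^ 2 * (S0 + S1) ≤ 2 * N := by
      calc 2 * (N : ℝ) ^ 2 * (S0 + S1) ≤ 2 * (N : ℝ) ^ 2 * (N * (v : ℝ)) := by gcongr
        _ = 2 * N * (N ^ 2 * (v : ℝ)) := by ring
        _ ≤ 2 * N * 1 := by gcongr
        _ = 2 * N := mul_one _
    have h2 : Real.log 3 ≤ 2 := by
      linarith [Real.log_le_sub_one_of_pos (by norm_num : (0 : ℝ) < 3)]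
    have h3 : N * (Real.log (Fintype.card (∀ i, α i)) - Real.log N + Real.log 3 + 1 / 2) ≤
        N * (D + 7 / 2) := mul_le_mul_of_nonneg_left (by linarith) hN'.le
    nlinarith
  have hsmall : d ^ 2 / (2 * v) = Real.exp (-4) / (16 * D) := by
    rw [hd]; field_simp; norm_num
  have hd1 : d ^ 2 / (2 * v) ≤ 1 := by
    rw [hsmall, div_le_one (by positivity)]; linarith
  have hLC : ∑ k ∈ Finset.range N, d ^ 2 / 2 * (1 - Real.exp 4 * (d ^ 2 / (2 * v)) *
      (∑ z, Real.negMulLog (transcriptProb T v (k / N) z) +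
        ∑ z, Real.negMulLog (transcriptProb T v (d + k / N) z))) ≤ S0 + S1 := by
    rw [← Finset.sum_add_distrib]
    refine Finset.sum_le_sum fun k _ => ?_
    rw [add_comm d]
    exact sq_mul_one_sub_entropy_le_transcriptRisk_add hv hT e _ hd1
  rw [← Finset.mul_sum, Finset.sum_sub_distrib, ← Finset.mul_sum, Finset.sum_add_distrib,
    Finset.sum_const, Finset.card_range, nsmul_eq_mul, mul_one, hsmall] at hLC
  change d ^ 2 / 2 * (N - Real.exp 4 * (Real.exp (-4) / (16 * D)) * (E0 + E1)) ≤ S0 + S1 at hLC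
  have hcoef : Real.exp 4 * (Real.exp (-4) / (16 * D)) = 1 / (16 * D) := by
    rw [mul_div_assoc', ← Real.exp_add]; norm_num
  rw [hcoef] at hLC
  have hhalf : 1 / (16 * D) * (E0 + E1) ≤ N / 2 := by
    calc 1 / (16 * D) * (E0 + E1) ≤ 1 / (16 * D) * (8 * N * D) := by gcongr
      _ = N / 2 := by field_simp; norm_num
  refine le_trans ?_ hLC
  calc 2 * N * (Real.exp (-4) / 64 * (v / D)) = d ^ 2 / 2 * (N - N / 2) := by rw [hd]; ring
    _ ≤ _ := by gcongr

end Transcript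

/-! ### The three regimes -/

section Risk

variable {m : ℕ} (b : Fin m → ℕ) {σ : ℝ}

theorem two_rpow_le_distributedMinimaxRisk :
    ENNReal.ofReal (1 / 32 * (2 : ℝ) ^ (-2 * ((∑ i, b i : ℕ) : ℝ))) ≤
      distributedMinimaxRisk b σ := by
  set B := ∑ i, b i with hB
  have hM0 : 0 < 2 ^ B := by positivity
  refine ofReal_le_distributedMinimaxRisk (Finset.range (2 * 2 ^ B)) (by simp)
    (fun j => j / (2 * (2 ^ B : ℕ))) (fun j hj => ⟨by positivity, ?_⟩) fun T hT e => ?_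
  · rw [div_le_one (by positivity)]
    exact_mod_cast (Finset.mem_range.mp hj).le
  · refine le_trans (le_of_eq ?_)
      (le_sum_transcriptRisk_of_card hT e ((card_transcript b).trans (by rw [hB])) hM0)
    rw [Finset.card_range]
    congr 1
    rw [mul_comm (-2 : ℝ), Real.rpow_mul two_pos.le, Real.rpow_natCast, Real.rpow_neg (by positivity)]
    push_cast
    rw [Real.rpow_ofNat]
    field_simp

theorem min_le_distributedMinimaxRisk (hm : 1 ≤ m) (hσ : 0 < σ) :
    ENNReal.ofReal (1 / 8 * min (σ ^ 2 / m) 1) ≤ distributedMinimaxRisk b σ := by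
  have hm' : (0 : ℝ) < m := by exact_mod_cast hm
  set r := min (σ ^ 2 / m) 1 with hr
  have hr0 : 0 ≤ r := le_min (by positivity) zero_le_one
  have hr1 : √r ≤ 1 := Real.sqrt_le_one.mpr (min_le_right _ _)
  refine ofReal_le_distributedMinimaxRisk (Finset.range 2) (by simp) (fun j => j * √r)
    (fun j hj => ⟨by positivity, ?_⟩) fun T hT e => ?_
  · have : (j : ℝ) ≤ 1 := by exact_mod_cast Nat.lt_succ_iff.mp (Finset.mem_range.mp hj)
    exact mul_le_one₀ this (Real.sqrt_nonneg _) hr1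
  · have hv : (σ ^ 2).toNNReal ≠ 0 := (Real.toNNReal_pos.mpr (by positivity)).ne'
    have h := sq_mul_exp_le_transcriptRisk_add hv hT e 0 (√r)
    rw [Real.sq_sqrt hr0, Real.coe_toNNReal _ (sq_nonneg σ), zero_add] at h
    have h1 : m * (r / (4 * σ ^ 2)) ≤ 1 / 4 := by
      calc m * (r / (4 * σ ^ 2)) ≤ m * (σ ^ 2 / m / (4 * σ ^ 2)) := by
            gcongr; exact min_le_left _ _
        _ = 1 / 4 := by field_simp
    have h2 : 1 / 2 ≤ Real.exp (-(m * (r / (4 * σ ^ 2)))) := by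
      linarith [Real.add_one_le_exp (-(m * (r / (4 * σ ^ 2))))]
    simp only [Finset.sum_range_succ, Finset.sum_range_zero, Finset.card_range, Nat.cast_zero,
      Nat.cast_one, zero_mul, one_mul, zero_add]
    push_cast
    nlinarith

theorem div_le_distributedMinimaxRisk (hσ : 0 < σ) (hσ1 : σ ≤ 1) {D : ℝ} (hD : 2 ≤ D)
    (hB : ((∑ i, b i : ℕ) : ℝ) - Real.logb 2 (1 / σ) ≤ D) :
    ENNReal.ofReal (Real.exp (-4) / 64 * (σ ^ 2 / D)) ≤ distributedMinimaxRisk b σ := by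
  have hD0 : 0 < D := by linarith
  -- The largest grid in `[0, 1]` with spacing at least `σ`.
  set N := ⌊1 / σ⌋₊ with hN
  have h1σ : 1 ≤ 1 / σ := by rwa [le_div_iff₀ hσ, one_mul]
  have hN1 : 1 ≤ N := Nat.le_floor (by exact_mod_cast h1σ)
  have hN1' : (1 : ℝ) ≤ N := by exact_mod_cast hN1
  have hNle : N * σ ≤ 1 := by
    rw [← le_div_iff₀ hσ]; exact Nat.floor_le (by positivity)
  have hNge : 1 / σ ≤ 2 * N := by linarith [Nat.lt_floor_add_one (1 / σ)]
  set d := σ * √(Real.exp (-4) / 8 / D) with hd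
  have hd2 : d ^ 2 = Real.exp (-4) / 8 * (σ ^ 2 / D) := by
    rw [hd, mul_pow, Real.sq_sqrt (by positivity)]; ring
  have hexp : Real.exp (-4) ≤ 1 := Real.exp_le_one_iff.mpr (by norm_num)
  have hd0 : 0 ≤ d := by positivity
  have hdσ : d ≤ σ := by
    refine mul_le_of_le_one_right hσ.le (Real.sqrt_le_one.mpr ?_)
    rw [div_le_one hD0]; linarith
  refine ofReal_le_distributedMinimaxRisk (Finset.range N ×ˢ Finset.range 2)
    (by simp [Finset.nonempty_range_iff]; omega) (fun q => q.2 * d + q.1 / N)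
    (fun q hq => ⟨by positivity, ?_⟩) fun T hT e => ?_
  · obtain ⟨hq1, hq2⟩ := Finset.mem_product.mp hq
    have h1 : (q.2 : ℝ) ≤ 1 := by exact_mod_cast Nat.lt_succ_iff.mp (Finset.mem_range.mp hq2)
    have h2 : (q.1 : ℝ) + 1 ≤ N := by exact_mod_cast Finset.mem_range.mp hq1
    have h3 : (q.2 : ℝ) * d ≤ 1 / N := by
      rw [le_div_iff₀ (by positivity)]
      calc (q.2 : ℝ) * d * N ≤ 1 * σ * N := by gcongr
        _ ≤ 1 := by linarith
    calc (q.2 : ℝ) * d + q.1 / N ≤ 1 / N + q.1 / N := by gcongr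
      _ = (q.1 + 1) / N := by ring
      _ ≤ 1 := by rw [div_le_one (by positivity)]; exact h2
  · have hv : (σ ^ 2).toNNReal ≠ 0 := (Real.toNNReal_pos.mpr (by positivity)).ne'
    have hcoe : ((σ ^ 2).toNNReal : ℝ) = σ ^ 2 := Real.coe_toNNReal _ (sq_nonneg σ)
    have hcard : Real.log (Fintype.card ((i : Fin m) → Fin (b i) → Bool)) - Real.log N ≤
        D + 1 := by
      have hl2 : Real.log 2 ≤ 1 := by linarith [Real.log_le_sub_one_of_pos (two_pos (α := ℝ))]
      have hl2' : 0 < Real.log 2 := Real.log_pos one_lt_two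
      have h1 : Real.log (1 / σ) ≤ Real.log 2 + Real.log N := by
        rw [← Real.log_mul (by norm_num) (by positivity)]
        exact Real.log_le_log (by positivity) hNge
      have h2 : Real.log (1 / σ) = Real.logb 2 (1 / σ) * Real.log 2 := by
        rw [Real.logb, div_mul_cancel₀ _ hl2'.ne']
      rw [card_transcript, Nat.cast_pow, Real.log_pow]
      push_cast at hB ⊢
      nlinarith
    have h := le_sum_transcriptRisk_grid hv hT e hN1
      (by rw [hcoe, ← mul_pow]; exact pow_le_one₀ (by positivity) hNle) hD hcard
      (by rw [hcoe]; exact hd2)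
    rw [hcoe] at h
    rw [Finset.sum_product_right, Finset.card_product, Finset.card_range, Finset.card_range]
    simp only [Finset.sum_range_succ, Finset.sum_range_zero, Nat.cast_zero, Nat.cast_one, zero_mul,
      one_mul, zero_add]
    push_cast
    linarith

end Risk

theorem theorem2 :
    ∃ c : ℝ, 0 < c ∧ ∀ (m : ℕ) (b : Fin m → ℕ) (σ : ℝ),
      1 ≤ m → (∀ i, 1 ≤ b i) → 0 < σ → ∀ B : ℕ, B = ∑ i, b i →
        ((B : ℝ) < Real.logb 2 (1 / σ) + 2 →
          ENNReal.ofReal (c * (2 : ℝ) ^ (-2 * (B : ℝ))) ≤ distributedMinimaxRisk b σ) ∧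
        (Real.logb 2 (1 / σ) + 2 ≤ (B : ℝ) → (B : ℝ) < Real.logb 2 (1 / σ) + (m : ℝ) →
          ENNReal.ofReal (c * (σ ^ 2 / ((B : ℝ) - Real.logb 2 (1 / σ)))) ≤ distributedMinimaxRisk b σ) ∧
        (Real.logb 2 (1 / σ) + (m : ℝ) ≤ (B : ℝ) →
          ENNReal.ofReal (c * min (σ ^ 2 / (m : ℝ)) 1) ≤ distributedMinimaxRisk b σ) := by
  have hexp : Real.exp (-4) ≤ 1 := Real.exp_le_one_iff.mpr (by norm_num)
  refine ⟨Real.exp (-4) / 64, by positivity, fun m b σ hm hb hσ B hB => ⟨fun _ => ?_,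
    fun hlo hhi => ?_, fun _ => ?_⟩⟩
  · refine le_trans (ENNReal.ofReal_le_ofReal ?_) (two_rpow_le_distributedMinimaxRisk b)
    rw [← hB]
    gcongr
    linarith
  · -- Since `m ≤ B`, the upper bound on `B` forces `σ < 1`.
    have hmB : (m : ℝ) ≤ B := by
      have : ∑ _i : Fin m, 1 ≤ ∑ i, b i := Finset.sum_le_sum fun i _ => hb i
      rw [← hB] at this
      exact_mod_cast (by simpa using this : m ≤ B)
    have hσ1 : σ ≤ 1 := by
      have hpos : 0 < Real.logb 2 (1 / σ) := by linarith
      rw [Real.logb_pos_iff one_lt_two (by positivity), lt_div_iff₀ hσ] at hpos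
      linarith
    exact div_le_distributedMinimaxRisk b hσ hσ1 (by linarith) (by rw [← hB])
  · refine le_trans (ENNReal.ofReal_le_ofReal ?_) (min_le_distributedMinimaxRisk b hm hσ)
    have : 0 ≤ min (σ ^ 2 / (m : ℝ)) 1 := le_min (by positivity) zero_le_one
    gcongr
    linarith
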